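/- An $n\times n$ alternating sign matrix is a square matrix with entries in $\{0,1,-1\}$ whose rows and columns each sum to $1$ (so each contains at least one nonzero entry) and in which the nonzero entries alternate in sign along every row and every column. Let $\mathrm{ASM}(n)$ be the set of all of them. For $A=(A_{ij})\in\mathrm{ASM}(n)$ put $$\nu(A)=\sum_{\substack{1\le i<k\le n\\ 1\le \ell\le j\le n}}A_{ij}A_{k\ell},$$ let $\mu(A)$ be the number of entries of $A$ equal to $-1$, and let $\rho(A)$ be the number of $0$'s to the left of the $1$ in the first row of $A$. The integer $\nu(A)$ is nonnegative, and the generating function is defined by $$Z_{\mathrm{ASM}}(n,x,y,z)=\sum_{A\in\mathrm{ASM}(n)}x^{\nu(A)}y^{\mu(A)}z^{\rho(A)}.$$ **Proposition.** For every $n\ge 0$ and every element $u$ of a commutative ring (in particular for an indeterminate $u$, or for $u\in\mathbb{C}$), $$Z_{\mathrm{ASM}}(n,u-1,u,1)=u^{n(n-1)/2},$$ where $0^0=1$ (and for $n=0$ the empty matrix is the only element of $\mathrm{ASM}(0)$, with $\nu=\mu=\rho=0$). -/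

import Mathlib

/-- A finite sequence of integers alternates in sign: if two nonzero terms are separated only by
zeros, they are opposite to each other. -/
def NonzeroAlternate {n : ℕ} (a : Fin n → ℤ) : Prop :=
  ∀ j k : Fin n, j < k → a j ≠ 0 → a k ≠ 0 → (∀ l : Fin n, j < l → l < k → a l = 0) → a k = -a j

instance {n : ℕ} (a : Fin n → ℤ) : Decidable (NonzeroAlternate a) := by
  unfold NonzeroAlternate; infer_instance

/-- Alternating sign matrices: entries `0, 1, -1`, every row and every column sums to `1`, and the
nonzero entries alternate in sign along every row and every column. (That every row and column has
a nonzero entry follows from the sums.) -/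
structure IsASM {n : ℕ} (A : Matrix (Fin n) (Fin n) ℤ) : Prop where
  entry : ∀ i j, A i j = 0 ∨ A i j = 1 ∨ A i j = -1
  row_sum : ∀ i, ∑ j, A i j = 1
  col_sum : ∀ j, ∑ i, A i j = 1
  row_alternate : ∀ i, NonzeroAlternate (fun j => A i j)
  col_alternate : ∀ j, NonzeroAlternate (fun i => A i j)

theorem isASM_iff {n : ℕ} (A : Fin n → Fin n → ℤ) :
    IsASM A ↔ (∀ i j, A i j = 0 ∨ A i j = 1 ∨ A i j = -1) ∧ (∀ i, ∑ j, A i j = 1) ∧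
      (∀ j, ∑ i, A i j = 1) ∧ (∀ i, NonzeroAlternate (A i)) ∧
      (∀ j, NonzeroAlternate (fun i => A i j)) :=
  ⟨fun h => ⟨h.1, h.2, h.3, h.4, h.5⟩, fun h => ⟨h.1, h.2.1, h.2.2.1, h.2.2.2.1, h.2.2.2.2⟩⟩

/-- Deciding `IsASM`, for matrices written as functions. -/
def decidableIsASM {n : ℕ} (A : Fin n → Fin n → ℤ) : Decidable (IsASM A) :=
  decidable_of_iff' _ (isASM_iff A)

instance {n : ℕ} (A : Matrix (Fin n) (Fin n) ℤ) : Decidable (IsASM A) := decidableIsASM A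

/-- The finite set `ASM(n)` of all `n × n` alternating sign matrices; see `mem_ASM`. -/
def ASM (n : ℕ) : Finset (Matrix (Fin n) (Fin n) ℤ) :=
  {A ∈ (Fintype.piFinset fun _ => Fintype.piFinset fun _ => {0, 1, -1} :
    Finset (Fin n → Fin n → ℤ)) | IsASM A}

theorem mem_ASM {n : ℕ} {A : Matrix (Fin n) (Fin n) ℤ} : A ∈ ASM n ↔ IsASM A := by
  unfold ASM
  refine Finset.mem_filter.trans ⟨fun h => h.2, fun h => ⟨?_, h⟩⟩
  refine Fintype.mem_piFinset.2 fun i => Fintype.mem_piFinset.2 fun j => ?_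
  simpa using h.entry i j

/-- The integer `ν(A) = ∑ A i j * A k l`, over all `i < k` and `l ≤ j`. -/
def asmNu {n : ℕ} (A : Matrix (Fin n) (Fin n) ℤ) : ℤ :=
  ∑ i, ∑ j, ∑ k, ∑ l, if i < k ∧ l ≤ j then A i j * A k l else 0

/-- `μ(A)`: the number of entries `-1` of `A`. -/
def asmMu {n : ℕ} (A : Matrix (Fin n) (Fin n) ℤ) : ℕ :=
  (Finset.univ.filter fun p : Fin n × Fin n => A p.1 p.2 = -1).card

/-- The number of terms `0` of a sequence that stand to the left of a term `1`. -/
def zerosLeftOfOne {n : ℕ} (a : Fin n → ℤ) : ℕ :=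
  (Finset.univ.filter fun j : Fin n => a j = 0 ∧ ∃ k : Fin n, j < k ∧ a k = 1).card

/-- `ρ(A)`: the number of entries `0` to the left of the `1` in the first row of `A` (the first row
of an alternating sign matrix has a single `1`). The empty matrix gets the value `0`. -/
def asmRho {n : ℕ} (A : Matrix (Fin n) (Fin n) ℤ) : ℕ :=
  if h : 0 < n then zerosLeftOfOne (A ⟨0, h⟩) else 0

theorem NonzeroAlternate.abs_window_le {n : ℕ} {a : Fin n → ℤ} (h : NonzeroAlternate a)
    (ha : ∀ j, a j = 0 ∨ a j = 1 ∨ a j = -1) (p m : ℕ) (hm : m ≤ n) :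
    |∑ l, if p ≤ l.val ∧ l.val < m then a l else 0| ≤ 1 := by
  suffices H : (∑ l, if p ≤ l.val ∧ l.val < m then a l else 0) = 0 ∨
      ∃ j : Fin n, j.val < m ∧ a j ≠ 0 ∧ (∀ l : Fin n, j < l → l.val < m → a l = 0) ∧
        (∑ l, if p ≤ l.val ∧ l.val < m then a l else 0) = a j by
    rcases H with H | ⟨j, -, -, -, H⟩
    · rw [H]; norm_num
    · rw [H]; rcases ha j with h | h | h <;> rw [h] <;> norm_num
  induction m with
  | zero => left; simp
  | succ m ih =>
    have step : (∑ l : Fin n, if p ≤ l.val ∧ l.val < m + 1 then a l else 0) =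
        (∑ l : Fin n, if p ≤ l.val ∧ l.val < m then a l else 0) +
          if p ≤ m then a ⟨m, hm⟩ else 0 := by
      have : (if p ≤ m then a ⟨m, hm⟩ else 0) =
          ∑ l : Fin n, if l = ⟨m, hm⟩ then (if p ≤ m then a ⟨m, hm⟩ else 0) else 0 := by simp
      rw [this, ← Finset.sum_add_distrib]
      refine Finset.sum_congr rfl fun l _ => ?_
      by_cases hl : l = ⟨m, hm⟩
      · subst hl; simp
      · have : l.val ≠ m := fun h => hl (Fin.ext h)
        have h2 : l.val < m + 1 ↔ l.val < m := by omega
        simp [hl, h2]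
    rw [step]
    by_cases hp : p ≤ m
    · rw [if_pos hp]
      by_cases h0 : a ⟨m, hm⟩ = 0
      · rw [h0, add_zero]
        refine (ih (by omega)).imp id ?_
        rintro ⟨j, h1, h2, h3, h4⟩
        refine ⟨j, by omega, h2, fun l hl hl' => ?_, h4⟩
        by_cases e : l.val = m
        · rw [show l = ⟨m, hm⟩ from Fin.ext e, h0]
        · exact h3 l hl (by omega)
      · rcases ih (by omega) with H | ⟨j, h1, h2, h3, h4⟩
        · right
          refine ⟨⟨m, hm⟩, by simp, h0, fun l hl hl' => ?_, by rw [H, zero_add]⟩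
          have : m < l.val := hl
          omega
        · left
          rw [h4, h j ⟨m, hm⟩ h1 h2 h0 fun l hl hl' => h3 l hl hl']
          ring
    · left
      rw [if_neg hp, add_zero]
      refine Finset.sum_eq_zero fun l _ => if_neg (by omega)

theorem NonzeroAlternate.prefix_nonneg {n : ℕ} {a : Fin n → ℤ} (h : NonzeroAlternate a)
    (ha : ∀ j, a j = 0 ∨ a j = 1 ∨ a j = -1) (hs : ∑ j, a j = 1) (m : ℕ) :
    0 ≤ ∑ l, if l.val < m then a l else 0 := by
  have h2 := abs_le.1 (h.abs_window_le ha m n le_rfl)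
  have key : (∑ l, if l.val < m then a l else 0) +
      (∑ l, if m ≤ l.val ∧ l.val < n then a l else 0) = 1 := by
    rw [← hs, ← Finset.sum_add_distrib]
    refine Finset.sum_congr rfl fun l _ => ?_
    have := l.isLt
    by_cases hl : l.val < m
    · rw [if_pos hl, if_neg (by omega), add_zero]
    · rw [if_neg hl, if_pos (by omega), zero_add]
  linarith [h2.2]

/-- `ν(A)` is nonnegative for an alternating sign matrix, so that it can be used as an exponent. -/
theorem IsASM.nu_nonneg {n : ℕ} {A : Matrix (Fin n) (Fin n) ℤ} (h : IsASM A) : 0 ≤ asmNu A := by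
  have key : asmNu A = ∑ j, ∑ k, (∑ i : Fin n, if i.val < k.val then A i j else 0) *
      (∑ l : Fin n, if l.val < j.val + 1 then A k l else 0) := by
    unfold asmNu
    rw [Finset.sum_comm]
    refine Finset.sum_congr rfl fun j _ => ?_
    rw [Finset.sum_comm]
    refine Finset.sum_congr rfl fun k _ => ?_
    rw [Finset.sum_mul_sum]
    refine Finset.sum_congr rfl fun i _ => Finset.sum_congr rfl fun l _ => ?_
    simp only [Fin.lt_def, Fin.le_def, Nat.lt_succ_iff]
    split_ifs <;> simp_all
  rw [key]
  refine Finset.sum_nonneg fun j _ => Finset.sum_nonneg fun k _ => mul_nonneg ?_ ?_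
  · exact (h.col_alternate j).prefix_nonneg (fun i => h.entry i j) (h.col_sum j) _
  · exact (h.row_alternate k).prefix_nonneg (h.entry k) (h.row_sum k) _

/-- The generating function `Z_ASM(n, x, y, z) = ∑ x ^ ν(A) * y ^ μ(A) * z ^ ρ(A)` over all `A` in
`ASM(n)`. Here `Int.toNat` loses nothing, by `IsASM.nu_nonneg`. -/
def ZASM {R : Type*} [CommRing R] (n : ℕ) (x y z : R) : R :=
  ∑ A ∈ ASM n, x ^ (asmNu A).toNat * y ^ asmMu A * z ^ asmRho A

/-! Let `S_k` be the set of columns whose first `k` entries sum to `1`. An alternating sign matrix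
is the same as a chain `S_0 = ∅, ..., S_n = univ` in which consecutive sets, listed increasingly,
interlace: a monotone triangle. Both `ν` and `μ` are sums over the rows, and for `y = x + 1` the
weight of a row is a product over the entries `b` of the upper set: `x` if `b` equals its right
neighbour below, `1` if its left one, `x + 1` strictly between (`rowWeight_image`).

With these weights the binomial determinant `det (choose (a i) j)` is an eigenfunction of summation
over interlacing rows, with factor `(x + 1) ^ k` (`sum_prod_entryWeight_mul_det`): by multilinearity
the sum is taken row by row, each row sum telescopes, and the differences are undone by bordering.
Induction gives `triangleSum_image`; for the full set the determinant is `1`. -/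

/-! ### Weighted binomial sums and determinants -/

theorem sum_Ico_choose {R : Type*} [CommRing R] {p q : ℕ} (h : p ≤ q) (j : ℕ) :
    ∑ b ∈ Finset.Ico p q, (b.choose j : R) = q.choose (j + 1) - p.choose (j + 1) := by
  induction q, h using Nat.le_induction with
  | base => simp
  | succ q hq ih =>
    rw [Finset.sum_Ico_succ_top hq, ih, Nat.choose_succ_succ' q j]
    push_cast
    ring

/-- The weight of the entry `b` of a monotone triangle standing between the entries `p` and `q`. -/
def entryWeight {R α : Type*} [CommRing R] [DecidableEq α] (x : R) (p q b : α) : R :=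
  if b = q then x else if b = p then 1 else x + 1

/-- Relative to the constant weight `x + 1` on `[p, q)`, the weights add `x` at `q` and remove `x`
at `p`. So the sum is a difference of one function at `q` and `p`. -/
theorem sum_entryWeight_mul_choose {R : Type*} [CommRing R] (x : R) {p q : ℕ} (h : p < q)
    (j : ℕ) :
    ∑ b ∈ Finset.Icc p q, entryWeight x p q b * (b.choose j : R) =
      ((x + 1) * q.choose (j + 1) + x * q.choose j) -
        ((x + 1) * p.choose (j + 1) + x * p.choose j) := by
  have h1 := sum_Ico_choose (R := R) h.le j
  rw [← Finset.sum_Ioo_add_eq_sum_Ico h] at h1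
  rw [← Finset.sum_Ico_add_eq_sum_Icc h.le, ← Finset.sum_Ioo_add_eq_sum_Ico h]
  have h2 : ∑ b ∈ Finset.Ioo p q, entryWeight x p q b * (b.choose j : R) =
      (x + 1) * ∑ b ∈ Finset.Ioo p q, (b.choose j : R) := by
    rw [Finset.mul_sum]
    refine Finset.sum_congr rfl fun b hb => ?_
    obtain ⟨h3, h4⟩ := Finset.mem_Ioo.1 hb
    rw [entryWeight, if_neg h4.ne, if_neg h3.ne']
  rw [h2, eq_sub_of_add_eq h1]
  simp only [entryWeight, h.ne, if_true, if_false]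
  ring

/-- The matrix of binomial coefficients `a i` over `j`. -/
def chooseMatrix (R : Type*) [CommRing R] {k : ℕ} (a : Fin k → ℕ) : Matrix (Fin k) (Fin k) R :=
  Matrix.of fun i j => ((a i).choose j : R)

theorem det_choose_sub_choose {R : Type*} [CommRing R] (x : R) {k : ℕ} (a : Fin (k + 1) → ℕ) :
    Matrix.det (Matrix.of fun i j : Fin k =>
      ((x + 1) * ((a i.succ).choose (j + 1) : R) + x * (a i.succ).choose j) -
        ((x + 1) * (a i.castSucc).choose (j + 1) + x * (a i.castSucc).choose j)) =
      (x + 1) ^ k * (chooseMatrix R a).det := by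
  -- `H` borders the undifferenced matrix with a column of ones; `U` expresses its columns in the
  -- binomial ones, with diagonal `1, x + 1, ..., x + 1`.
  let U : Matrix (Fin (k + 1)) (Fin (k + 1)) R := Matrix.of fun l j =>
    Fin.cases (if l = 0 then 1 else 0)
      (fun j => (if l = j.succ then x + 1 else 0) + (if l = j.castSucc then x else 0)) j
  let H : Matrix (Fin (k + 1)) (Fin (k + 1)) R := Matrix.of fun i j =>
    Fin.cases 1 (fun j => (x + 1) * ((a i).choose (j + 1) : R) + x * (a i).choose j) j
  have hU : U.det = (x + 1) ^ k := by
    rw [Matrix.det_of_isUpperTriangular, Fin.prod_univ_succ]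
    · simp [U, Fin.castSucc_lt_succ.ne']
    · intro i j hij
      simp only [id] at hij
      induction j using Fin.cases with
      | zero => simp [U, hij.ne']
      | succ j => simp [U, hij.ne', (Fin.castSucc_lt_succ.trans hij).ne']
  have hH : H = chooseMatrix R a * U := by
    ext i j
    induction j using Fin.cases with
    | zero => simp [H, U, chooseMatrix, Matrix.mul_apply]
    | succ j =>
      simp [H, U, chooseMatrix, Matrix.mul_apply, mul_add, Finset.sum_add_distrib]
      ring
  -- Subtracting from each row its predecessor turns the column of ones into `1, 0, ..., 0`.
  let D : Matrix (Fin (k + 1)) (Fin (k + 1)) R := Matrix.of fun i j =>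
    Fin.cases (H 0 j) (fun i => H i.succ j - H i.castSucc j) i
  have hD : H.det = D.det :=
    Matrix.det_eq_of_forall_row_eq_smul_add_pred (fun _ => 1) (fun j => by simp [D])
      (fun i j => by simp [D])
  rw [mul_comm, ← hU, ← Matrix.det_mul, ← hH, hD, Matrix.det_succ_column_zero,
    Fin.sum_univ_succ, Finset.sum_eq_zero (fun i _ => by simp [D, H])]
  simp only [Fin.val_zero, pow_zero, one_mul, add_zero]
  rw [show D 0 0 = 1 by simp [D, H], one_mul]
  congr 1

theorem det_chooseMatrix_val {R : Type*} [CommRing R] (n : ℕ) :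
    (chooseMatrix R (fun i : Fin n => i.val)).det = 1 := by
  rw [Matrix.det_of_isLowerTriangular]
  · simp [chooseMatrix]
  · intro i j hij
    have : i.val < j.val := hij
    simp [chooseMatrix, Nat.choose_eq_zero_of_lt this]

theorem det_of_sum_rows {R ι : Type*} [CommRing R] [DecidableEq ι] {k : ℕ}
    (s : Fin k → Finset ι) (w : Fin k → ι → R) (f : ι → Fin k → R) :
    Matrix.det (Matrix.of fun i j => ∑ b ∈ s i, w i b * f b j) =
      ∑ b ∈ Fintype.piFinset s, (∏ i, w i (b i)) * Matrix.det (Matrix.of fun i j => f (b i) j) := by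
  have h := MultilinearMap.map_sum_finset
    (Matrix.detRowAlternating (R := R) (n := Fin k)).toMultilinearMap (fun i b => w i b • f b) s
  calc _ = Matrix.det (fun i => ∑ b ∈ s i, w i b • f b) := by
        congr 1; ext i j; simp [Finset.sum_apply]
    _ = _ := h
    _ = _ := by
        refine Finset.sum_congr rfl fun b _ => ?_
        exact MultilinearMap.map_smul_univ
          (Matrix.detRowAlternating (R := R) (n := Fin k)).toMultilinearMap
          (fun i => w i (b i)) (fun i => f (b i))

/-- The sum over all rows interlacing with a given row `a` of a monotone triangle. -/
theorem sum_prod_entryWeight_mul_det {R : Type*} [CommRing R] (x : R) {n k : ℕ}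
    {a : Fin (k + 1) → Fin n} (ha : StrictMono a) :
    ∑ b ∈ Fintype.piFinset fun i : Fin k => Finset.Icc (a i.castSucc) (a i.succ),
      (∏ i, entryWeight x (a i.castSucc) (a i.succ) (b i)) *
        (chooseMatrix R fun i => (b i).val).det =
      (x + 1) ^ k * (chooseMatrix R fun i => (a i).val).det := by
  rw [← det_choose_sub_choose]
  refine (det_of_sum_rows _ (fun i : Fin k => entryWeight x (a i.castSucc) (a i.succ))
    (fun b j => (b.val.choose j : R))).symm.trans ?_
  congr 1
  ext i j
  simp only [Matrix.of_apply]
  have hi : (a i.castSucc).val < (a i.succ).val := ha Fin.castSucc_lt_succ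
  rw [← sum_entryWeight_mul_choose x hi, ← Fin.map_valEmbedding_Icc, Finset.sum_map]
  refine Finset.sum_congr rfl fun b _ => ?_
  simp [entryWeight, Fin.ext_iff]

/-! ### Sign rows and interlacing -/

/-- The sum of the first `m` terms of a sequence. -/
def prefixSum {n : ℕ} (a : Fin n → ℤ) (m : ℕ) : ℤ :=
  ∑ l, if l.val < m then a l else 0

/-- The rows and columns of alternating sign matrices: all prefix sums are `0` or `1`, and the
total is `1`. -/
structure IsSignRow {n : ℕ} (a : Fin n → ℤ) : Prop where
  prefixSum_mem : ∀ m, prefixSum a m = 0 ∨ prefixSum a m = 1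
  sum_eq : ∑ j, a j = 1

/-- The difference of the indicator functions of `S` and `T`. -/
def indicatorDiff {n : ℕ} (T S : Finset (Fin n)) (j : Fin n) : ℤ :=
  (if j ∈ S then 1 else 0) - (if j ∈ T then 1 else 0)

theorem prefixSum_zero {n : ℕ} (a : Fin n → ℤ) : prefixSum a 0 = 0 := by
  simp [prefixSum]

theorem prefixSum_of_le {n : ℕ} (a : Fin n → ℤ) {m : ℕ} (h : n ≤ m) :
    prefixSum a m = ∑ j, a j :=
  Finset.sum_congr rfl fun l _ => if_pos (l.isLt.trans_le h)

theorem prefixSum_succ {n : ℕ} (a : Fin n → ℤ) (k : Fin n) :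
    prefixSum a (k + 1) = prefixSum a k + a k := by
  have : a k = ∑ l, if l = k then a l else 0 := by simp
  rw [this, prefixSum, prefixSum, ← Finset.sum_add_distrib]
  refine Finset.sum_congr rfl fun l _ => ?_
  rcases lt_trichotomy l k with h | h | h
  · have h' : l.val < k.val := h
    rw [if_pos (by omega), if_pos h', if_neg h.ne, add_zero]
  · subst h; simp
  · have h' : k.val < l.val := h
    rw [if_neg (by omega), if_neg (by omega), if_neg h.ne', add_zero]

theorem IsSignRow.of_alternate {n : ℕ} {a : Fin n → ℤ} (h : NonzeroAlternate a)
    (ha : ∀ j, a j = 0 ∨ a j = 1 ∨ a j = -1) (hs : ∑ j, a j = 1) : IsSignRow a := by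
  refine ⟨fun m => ?_, hs⟩
  rcases le_total n m with hm | hm
  · exact Or.inr ((prefixSum_of_le a hm).trans hs)
  · have h1 : 0 ≤ prefixSum a m := h.prefix_nonneg ha hs m
    have h2 := (abs_le.1 (h.abs_window_le ha 0 m hm)).2
    have h3 : prefixSum a m ≤ 1 := by simpa [prefixSum] using h2
    omega

theorem IsSignRow.entry {n : ℕ} {a : Fin n → ℤ} (h : IsSignRow a) (j : Fin n) :
    a j = 0 ∨ a j = 1 ∨ a j = -1 := by
  have h1 := prefixSum_succ a j
  have h2 := h.prefixSum_mem j
  have h3 := h.prefixSum_mem (j + 1)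
  omega

theorem IsSignRow.alternate {n : ℕ} {a : Fin n → ℤ} (h : IsSignRow a) : NonzeroAlternate a := by
  intro j k hjk hj hk h0
  have hjk' : j.val < k.val := hjk
  have e : prefixSum a k = prefixSum a (j + 1) := by
    refine Finset.sum_congr rfl fun l _ => ?_
    by_cases hl : l.val < j.val + 1
    · rw [if_pos hl, if_pos (by omega)]
    · rw [if_neg hl]
      split_ifs with hl'
      · exact h0 l (Fin.lt_def.2 (by omega)) hl'
      · rfl
  have h1 := prefixSum_succ a j
  have h2 := prefixSum_succ a k
  have h3 := h.prefixSum_mem j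
  have h4 := h.prefixSum_mem (j + 1)
  have h5 := h.prefixSum_mem (k + 1)
  omega

theorem isASM_iff_isSignRow {n : ℕ} (A : Matrix (Fin n) (Fin n) ℤ) :
    IsASM A ↔ (∀ i, IsSignRow (A i)) ∧ ∀ j, IsSignRow fun i => A i j :=
  ⟨fun h => ⟨fun i => .of_alternate (h.row_alternate i) (h.entry i) (h.row_sum i),
    fun j => .of_alternate (h.col_alternate j) (fun i => h.entry i j) (h.col_sum j)⟩,
   fun h => ⟨fun i => (h.1 i).entry, fun i => (h.1 i).sum_eq, fun j => (h.2 j).sum_eq,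
    fun i => (h.1 i).alternate, fun j => (h.2 j).alternate⟩⟩

/-- The indices with value below `m` form an initial segment. This turns interlacing into
inequalities between counts. -/
theorem lt_card_filter_lt_iff {n k : ℕ} {a : Fin k → Fin n} (ha : StrictMono a) (i : Fin k)
    (m : ℕ) : i.val < (Finset.univ.filter fun i => (a i).val < m).card ↔ (a i).val < m := by
  constructor
  · contrapose!
    intro h
    rw [← Fin.card_Iio i]
    refine Finset.card_le_card fun l hl => Finset.mem_Iio.2 (ha.lt_iff_lt.1 ?_)
    exact Fin.lt_def.2 ((Finset.mem_filter.1 hl).2.trans_le h)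
  · intro h
    rw [← Nat.succ_le_iff, Nat.succ_eq_add_one, ← Fin.card_Iic i]
    refine Finset.card_le_card fun l hl => Finset.mem_filter.2 ⟨Finset.mem_univ _, ?_⟩
    exact (Fin.le_def.1 (ha.monotone (Finset.mem_Iic.1 hl))).trans_lt h

theorem prefixSum_indicatorDiff_image {n k l : ℕ} {a : Fin k → Fin n} {b : Fin l → Fin n}
    (ha : StrictMono a) (hb : StrictMono b) (m : ℕ) :
    prefixSum (indicatorDiff (Finset.univ.image b) (Finset.univ.image a)) m =
      ((Finset.univ.filter fun i => (a i).val < m).card : ℤ) -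
        (Finset.univ.filter fun i => (b i).val < m).card := by
  have key : ∀ {k : ℕ} {a : Fin k → Fin n}, StrictMono a →
      (∑ j, if j.val < m then (if j ∈ Finset.univ.image a then (1 : ℤ) else 0) else 0) =
        (Finset.univ.filter fun i => (a i).val < m).card := by
    intro k a ha
    rw [Finset.sum_congr rfl fun j _ => (by split_ifs <;> simp_all :
      (if j.val < m then (if j ∈ Finset.univ.image a then (1 : ℤ) else 0) else 0) =
        if j ∈ Finset.univ.image a then (if j.val < m then 1 else 0) else 0),
      ← Finset.sum_filter, Finset.filter_univ_mem, Finset.sum_image ha.injective.injOn]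
    simp
  rw [← key ha, ← key hb, prefixSum, ← Finset.sum_sub_distrib]
  refine Finset.sum_congr rfl fun j _ => ?_
  unfold indicatorDiff
  split_ifs <;> simp

theorem sum_indicatorDiff {n : ℕ} (T S : Finset (Fin n)) :
    ∑ j, indicatorDiff T S j = (S.card : ℤ) - T.card := by
  simp [indicatorDiff, Finset.sum_sub_distrib]

/-- A prefix sum counts the `a`'s below `m` minus the `b`'s below `m`; interlacing says that the
first count exceeds the second by `0` or `1`. -/
theorem isSignRow_indicatorDiff_image_iff {n k : ℕ} {a : Fin (k + 1) → Fin n}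
    {b : Fin k → Fin n} (ha : StrictMono a) (hb : StrictMono b) :
    IsSignRow (indicatorDiff (Finset.univ.image b) (Finset.univ.image a)) ↔
      ∀ i, a i.castSucc ≤ b i ∧ b i ≤ a i.succ := by
  constructor
  · intro h i
    simp only [Fin.le_def]
    have key := fun m => h.prefixSum_mem m
    simp only [prefixSum_indicatorDiff_image ha hb] at key
    have h1 := lt_card_filter_lt_iff ha i.castSucc ((b i).val + 1)
    have h2 := lt_card_filter_lt_iff hb i ((b i).val + 1)
    have h3 := lt_card_filter_lt_iff ha i.succ (b i).val
    have h4 := lt_card_filter_lt_iff hb i (b i).val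
    have h5 := key ((b i).val + 1)
    have h6 := key (b i).val
    simp only [Fin.val_castSucc, Fin.val_succ] at h1 h3
    omega
  · intro h
    refine ⟨fun m => ?_, ?_⟩
    · rw [prefixSum_indicatorDiff_image ha hb]
      set p := (Finset.univ.filter fun i => (a i).val < m).card with hp
      set q := (Finset.univ.filter fun i => (b i).val < m).card with hq
      have hpk : p ≤ k + 1 := (Finset.card_le_univ _).trans (by simp)
      have hqk : q ≤ k := (Finset.card_le_univ _).trans (by simp)
      -- If `p < q`, then `b p < m ≤ a p`, against interlacing at index `p`; the bound below is
      -- symmetric, at index `q`.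
      have h1 : q ≤ p := by
        by_contra hlt
        have hp' : p < k := by omega
        have e1 := lt_card_filter_lt_iff ha (Fin.castSucc ⟨p, hp'⟩) m
        have e2 := lt_card_filter_lt_iff hb ⟨p, hp'⟩ m
        have e3 := Fin.le_def.1 (h ⟨p, hp'⟩).1
        simp only [Fin.val_castSucc, ← hp, ← hq] at e1 e2
        omega
      have h2 : p ≤ q + 1 := by
        by_contra hlt
        have hq' : q < k := by omega
        have e1 := lt_card_filter_lt_iff ha (Fin.succ ⟨q, hq'⟩) m
        have e2 := lt_card_filter_lt_iff hb ⟨q, hq'⟩ m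
        have e3 := Fin.le_def.1 (h ⟨q, hq'⟩).2
        simp only [Fin.val_succ, ← hp, ← hq] at e1 e2
        omega
      omega
    · rw [sum_indicatorDiff, Finset.card_image_of_injective _ ha.injective,
        Finset.card_image_of_injective _ hb.injective]
      simp

/-! ### Row weights and the sum over monotone triangles -/

/-- The weight of a row `indicatorDiff T S` of an alternating sign matrix, where `T` and `S` are
the sets of columns with sum `1` above and below it. -/
def rowWeight {R : Type*} [CommRing R] {n : ℕ} (x y : R) (T S : Finset (Fin n)) : R :=
  x ^ (T.filter fun j => prefixSum (indicatorDiff T S) (j.val + 1) = 1).card * y ^ (T \ S).card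

theorem rowWeight_image {R : Type*} [CommRing R] (x : R) {n k : ℕ} {a : Fin (k + 1) → Fin n}
    {b : Fin k → Fin n} (ha : StrictMono a) (hb : StrictMono b)
    (h : ∀ i, a i.castSucc ≤ b i ∧ b i ≤ a i.succ) :
    rowWeight x (x + 1) (Finset.univ.image b) (Finset.univ.image a) =
      ∏ i, entryWeight x (a i.castSucc) (a i.succ) (b i) := by
  have hrow := (isSignRow_indicatorDiff_image_iff ha hb).2 h
  have h1 : ∀ i, prefixSum (indicatorDiff (Finset.univ.image b) (Finset.univ.image a))
      ((b i).val + 1) = 1 ↔ b i = a i.succ := by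
    intro i
    have hm := hrow.prefixSum_mem ((b i).val + 1)
    rw [prefixSum_indicatorDiff_image ha hb] at hm ⊢
    have e1 := lt_card_filter_lt_iff ha i.succ ((b i).val + 1)
    have e2 := lt_card_filter_lt_iff hb i ((b i).val + 1)
    -- Exactly `i + 1` of the `b`'s are at most `b i`, so the prefix sum is `1` iff `a i.succ ≤ b
    -- i`.
    have e3 : ¬ (i.val + 1 < (Finset.univ.filter fun l => (b l).val < (b i).val + 1).card) := by
      by_cases hi : i.val + 1 < k
      · have e4 := lt_card_filter_lt_iff hb ⟨i.val + 1, hi⟩ ((b i).val + 1)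
        have e5 : (b i).val < (b ⟨i.val + 1, hi⟩).val := hb (Fin.lt_def.2 (by simp))
        simp only at e4
        omega
      · have := Finset.card_le_univ (Finset.univ.filter fun l => (b l).val < (b i).val + 1)
        simp only [Fintype.card_fin] at this
        omega
    have e6 := Fin.le_def.1 (h i).2
    rw [Fin.ext_iff]
    simp only [Fin.val_succ] at e1
    omega
  have h2 : ∀ i, b i ∉ Finset.univ.image a ↔ b i ≠ a i.succ ∧ b i ≠ a i.castSucc := by
    intro i
    constructor
    · intro hi
      constructor <;> (intro e; exact hi (e ▸ Finset.mem_image_of_mem _ (Finset.mem_univ _)))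
    · rintro ⟨hi1, hi2⟩ hi
      obtain ⟨l, -, hl⟩ := Finset.mem_image.1 hi
      have l1 := lt_of_le_of_ne (h i).1 hi2.symm
      have l2 := lt_of_le_of_ne (h i).2 hi1
      rw [← hl, ha.lt_iff_lt, Fin.lt_def] at l1 l2
      simp only [Fin.val_succ, Fin.val_castSucc] at l1 l2
      omega
  have h3 : ∀ i : Fin k, a i.castSucc ≠ a i.succ := fun i => (ha Fin.castSucc_lt_succ).ne
  rw [rowWeight, Finset.sdiff_eq_filter, Finset.filter_image, Finset.filter_image,
    Finset.card_image_of_injective _ hb.injective, Finset.card_image_of_injective _ hb.injective,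
    ← Finset.prod_const, ← Finset.prod_const, Finset.prod_filter, Finset.prod_filter,
    ← Finset.prod_mul_distrib]
  refine Finset.prod_congr rfl fun i _ => ?_
  simp only [h1, h2, entryWeight]
  by_cases e1 : b i = a i.succ
  · simp [e1]
  · by_cases e2 : b i = a i.castSucc <;> simp [e1, e2, h3]

open Classical in
/-- The total weight of all sequences of `m` rows whose column sums are the indicator function of
a set, see `sum_prod_rowWeight`. -/
noncomputable def triangleSum {R : Type*} [CommRing R] {n : ℕ} (x y : R) : ℕ → Finset (Fin n) → R
  | 0, S => if S = ∅ then 1 else 0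
  | m + 1, S => ∑ T, if IsSignRow (indicatorDiff T S) then
      triangleSum x y m T * rowWeight x y T S else 0

theorem triangleSum_image {R : Type*} [CommRing R] (x : R) {n : ℕ} (k : ℕ) (a : Fin k → Fin n)
    (ha : StrictMono a) :
    triangleSum x (x + 1) k (Finset.univ.image a) =
      (x + 1) ^ (k * (k - 1) / 2) * (chooseMatrix R fun i => (a i).val).det := by
  classical
  induction k with
  | zero => simp [triangleSum]
  | succ k ih =>
    have hexp : (k + 1) * (k + 1 - 1) / 2 = k * (k - 1) / 2 + k := by
      rw [← Nat.choose_two_right, ← Nat.choose_two_right, Nat.choose_succ_succ' k 1]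
      simp [add_comm]
    rw [hexp, pow_add, mul_assoc, ← sum_prod_entryWeight_mul_det x ha, triangleSum,
      ← Finset.sum_filter, Finset.mul_sum]
    symm
    -- Interlacing tuples that are not strictly increasing have a repeated entry, hence two equal
    -- rows in the determinant, and contribute nothing.
    rw [← Finset.sum_filter_of_ne (p := StrictMono)]
    · refine Finset.sum_bij (fun b _ => Finset.univ.image b) ?_ ?_ ?_ ?_
      · intro b hb
        obtain ⟨hb1, hb2⟩ := Finset.mem_filter.1 hb
        refine Finset.mem_filter.2 ⟨Finset.mem_univ _,
          (isSignRow_indicatorDiff_image_iff ha hb2).2 fun i => ?_⟩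
        exact Finset.mem_Icc.1 (Fintype.mem_piFinset.1 hb1 i)
      · intro b hb c hc hbc
        refine (StrictMono.range_inj (Finset.mem_filter.1 hb).2 (Finset.mem_filter.1 hc).2).1 ?_
        simpa using congrArg (fun s : Finset (Fin n) => (s : Set (Fin n))) hbc
      · intro T hT
        have hT := (Finset.mem_filter.1 hT).2
        have hcard : T.card = k := by
          have := hT.sum_eq
          rw [sum_indicatorDiff, Finset.card_image_of_injective _ ha.injective] at this
          simp only [Finset.card_univ, Fintype.card_fin] at this
          omega
        have himg : Finset.univ.image (T.orderEmbOfFin hcard) = T :=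
          Finset.image_orderEmbOfFin_univ T hcard
        have hmono : StrictMono (T.orderEmbOfFin hcard) := (T.orderEmbOfFin hcard).strictMono
        refine ⟨T.orderEmbOfFin hcard, Finset.mem_filter.2
          ⟨Fintype.mem_piFinset.2 fun i => Finset.mem_Icc.2 ?_, hmono⟩, himg⟩
        rw [← himg] at hT
        exact (isSignRow_indicatorDiff_image_iff ha hmono).1 hT i
      · intro b hb
        obtain ⟨hb1, hb2⟩ := Finset.mem_filter.1 hb
        rw [ih b hb2, rowWeight_image x ha hb2 fun i =>
          Finset.mem_Icc.1 (Fintype.mem_piFinset.1 hb1 i)]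
        ring
    · intro b hb hne i j hij
      have hle : b i ≤ b j := (Finset.mem_Icc.1 (Fintype.mem_piFinset.1 hb i)).2.trans
        ((ha.monotone (Fin.le_def.2 (by simpa using hij))).trans
          (Finset.mem_Icc.1 (Fintype.mem_piFinset.1 hb j)).1)
      refine lt_of_le_of_ne hle fun e => hne ?_
      rw [Matrix.det_zero_of_row_eq hij.ne (by ext l; simp [chooseMatrix, e]), mul_zero, mul_zero]

theorem triangleSum_univ {R : Type*} [CommRing R] (x : R) (n : ℕ) :
    triangleSum x (x + 1) n (Finset.univ : Finset (Fin n)) = (x + 1) ^ (n * (n - 1) / 2) := by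
  simpa [det_chooseMatrix_val] using triangleSum_image x n (id : Fin n → Fin n) strictMono_id

open Classical in
-- The arbitrary `f` lets the induction remove the last set: its row weight is absorbed into a new
-- test function of the preceding set.
theorem sum_prod_rowWeight {R : Type*} [CommRing R] {n : ℕ} (x y : R) (m : ℕ)
    (f : Finset (Fin n) → R) :
    ∑ s : Fin (m + 1) → Finset (Fin n),
      (if s 0 = ∅ ∧ ∀ k : Fin m, IsSignRow (indicatorDiff (s k.castSucc) (s k.succ)) then
        (∏ k : Fin m, rowWeight x y (s k.castSucc) (s k.succ)) * f (s (Fin.last m)) else 0) =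
      ∑ S, triangleSum x y m S * f S := by
  induction m generalizing f with
  | zero =>
    rw [← (Equiv.funUnique (Fin 1) (Finset (Fin n))).symm.sum_comp]
    refine Finset.sum_congr rfl fun S _ => ?_
    simp [triangleSum]
  | succ m ih =>
    have h := ih fun T => ∑ S, if IsSignRow (indicatorDiff T S) then
      rowWeight x y T S * f S else 0
    rw [← (Fin.snocEquiv fun _ : Fin (m + 2) => Finset (Fin n)).sum_comp, Fintype.sum_prod_type,
      Finset.sum_comm]
    refine Eq.trans (Finset.sum_congr rfl fun s _ => ?_) (h.trans ?_)
    · have hs (S : Finset (Fin n)) (k : Fin m) :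
          Fin.snoc (α := fun _ : Fin (m + 2) => Finset (Fin n)) s S k.castSucc.succ =
            s k.succ := by
        rw [Fin.succ_castSucc]
        exact Fin.snoc_castSucc (α := fun _ => Finset (Fin n)) S s k.succ
      have hs0 (S : Finset (Fin n)) :
          Fin.snoc (α := fun _ : Fin (m + 2) => Finset (Fin n)) s S 0 = s 0 :=
        Fin.snoc_castSucc (α := fun _ => Finset (Fin n)) S s 0
      simp only [Fin.snocEquiv_apply, Fin.forall_fin_succ', Fin.prod_univ_castSucc,
        Fin.snoc_castSucc, Fin.snoc_last, Fin.succ_last, hs, hs0, ← and_assoc]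
      by_cases hP : s 0 = ∅ ∧ ∀ k : Fin m, IsSignRow (indicatorDiff (s k.castSucc) (s k.succ))
      · simp only [hP, implies_true, and_self, true_and, if_true, Finset.mul_sum]
        refine Finset.sum_congr rfl fun (S : Finset (Fin n)) _ => ?_
        split_ifs <;> ring
      · simp only [hP, false_and, if_false, Finset.sum_const_zero]
    · simp only [Finset.mul_sum, triangleSum, Finset.sum_mul]
      rw [Finset.sum_comm]
      refine Finset.sum_congr rfl fun S _ => Finset.sum_congr rfl fun T _ => ?_
      split_ifs <;> ring

/-! ### Alternating sign matrices as chains of sets -/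

/-- The alternating sign matrix given by the sequence of the sets of columns with partial
sum `1`. -/
def matrixOfChain {n : ℕ} (s : Fin (n + 1) → Finset (Fin n)) : Matrix (Fin n) (Fin n) ℤ :=
  fun k => indicatorDiff (s k.castSucc) (s k.succ)

/-- The sets of columns with partial sum `1`. -/
def chainOfMatrix {n : ℕ} (A : Matrix (Fin n) (Fin n) ℤ) (k : Fin (n + 1)) : Finset (Fin n) :=
  Finset.univ.filter fun j => prefixSum (fun i => A i j) k = 1

theorem prefixSum_matrixOfChain {n : ℕ} {s : Fin (n + 1) → Finset (Fin n)} (h0 : s 0 = ∅)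
    (j : Fin n) (k : Fin (n + 1)) :
    prefixSum (fun i => matrixOfChain s i j) k = if j ∈ s k then 1 else 0 := by
  induction k using Fin.induction with
  | zero => simp [prefixSum_zero, h0]
  | succ k ih =>
    rw [Fin.val_succ, prefixSum_succ]
    rw [Fin.val_castSucc] at ih
    rw [ih]
    simp [matrixOfChain, indicatorDiff]

theorem matrixOfChain_chainOfMatrix {n : ℕ} {A : Matrix (Fin n) (Fin n) ℤ}
    (hA : ∀ j, IsSignRow fun i => A i j) : matrixOfChain (chainOfMatrix A) = A := by
  ext k j
  have h1 := prefixSum_succ (fun i => A i j) k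
  have h2 := (hA j).prefixSum_mem k
  have h3 := (hA j).prefixSum_mem (k + 1)
  simp only [matrixOfChain, indicatorDiff, chainOfMatrix, Finset.mem_filter, Finset.mem_univ,
    true_and, Fin.val_succ, Fin.val_castSucc]
  split_ifs <;> omega

theorem isASM_matrixOfChain {n : ℕ} {s : Fin (n + 1) → Finset (Fin n)} (h0 : s 0 = ∅)
    (h1 : s (Fin.last n) = Finset.univ) (h : ∀ k, IsSignRow (matrixOfChain s k)) :
    IsASM (matrixOfChain s) := by
  refine (isASM_iff_isSignRow _).2 ⟨h, fun j => ?_⟩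
  have hsum : ∑ i, matrixOfChain s i j = 1 := by
    rw [← prefixSum_of_le (fun i => matrixOfChain s i j) le_rfl]
    simpa [h1] using prefixSum_matrixOfChain h0 j (Fin.last n)
  refine ⟨fun m => ?_, hsum⟩
  rcases le_total n m with hm | hm
  · exact Or.inr ((prefixSum_of_le _ hm).trans hsum)
  · have := prefixSum_matrixOfChain h0 j ⟨m, by omega⟩
    simp only at this
    rw [this]
    split_ifs <;> simp

/-- For fixed `j` and `k` the sums over `i < k` and `l ≤ j` are independent. On a chain both factors
are `0` or `1`, so `ν` becomes a count. -/
theorem asmNu_eq_sum_prefixSum {n : ℕ} (A : Matrix (Fin n) (Fin n) ℤ) :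
    asmNu A = ∑ k : Fin n, ∑ j : Fin n, prefixSum (fun i => A i j) k * prefixSum (A k) (j + 1) := by
  unfold asmNu prefixSum
  rw [Finset.sum_comm]
  conv_rhs => rw [Finset.sum_comm]
  refine Finset.sum_congr rfl fun j _ => ?_
  rw [Finset.sum_comm]
  refine Finset.sum_congr rfl fun k _ => ?_
  rw [Finset.sum_mul_sum]
  refine Finset.sum_congr rfl fun i _ => Finset.sum_congr rfl fun l _ => ?_
  simp only [Fin.lt_def, Fin.le_def, Nat.lt_succ_iff]
  split_ifs <;> simp_all

theorem asmNu_matrixOfChain {n : ℕ} {s : Fin (n + 1) → Finset (Fin n)} (h0 : s 0 = ∅)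
    (h : ∀ k, IsSignRow (matrixOfChain s k)) :
    (asmNu (matrixOfChain s)).toNat = ∑ k : Fin n, ((s k.castSucc).filter fun j =>
      prefixSum (indicatorDiff (s k.castSucc) (s k.succ)) (j.val + 1) = 1).card := by
  suffices H : asmNu (matrixOfChain s) = ((∑ k : Fin n, ((s k.castSucc).filter fun j =>
      prefixSum (indicatorDiff (s k.castSucc) (s k.succ)) (j.val + 1) = 1).card : ℕ) : ℤ) by
    rw [H, Int.toNat_natCast]
  rw [asmNu_eq_sum_prefixSum]
  push_cast
  refine Finset.sum_congr rfl fun k _ => ?_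
  rw [Finset.card_filter, ← Finset.filter_univ_mem (s k.castSucc), Finset.sum_filter]
  push_cast
  refine Finset.sum_congr rfl fun j _ => ?_
  have h1 := prefixSum_matrixOfChain h0 j k.castSucc
  rw [Fin.val_castSucc] at h1
  rw [h1, Finset.filter_univ_mem]
  have h2 := (h k).prefixSum_mem (j + 1)
  change prefixSum (indicatorDiff (s k.castSucc) (s k.succ)) (j + 1) = 0 ∨
    prefixSum (indicatorDiff (s k.castSucc) (s k.succ)) (j + 1) = 1 at h2
  change _ * prefixSum (indicatorDiff (s k.castSucc) (s k.succ)) (j + 1) = _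
  rcases h2 with h2 | h2 <;> rw [h2] <;> simp

theorem asmMu_matrixOfChain {n : ℕ} (s : Fin (n + 1) → Finset (Fin n)) :
    asmMu (matrixOfChain s) = ∑ k : Fin n, (s k.castSucc \ s k.succ).card := by
  rw [asmMu, Finset.card_filter, Fintype.sum_prod_type]
  refine Finset.sum_congr rfl fun k _ => ?_
  rw [← Finset.card_filter]
  congr 1
  ext j
  rw [Finset.mem_filter, Finset.mem_sdiff]
  simp only [matrixOfChain, indicatorDiff, Finset.mem_univ, true_and]
  split_ifs <;> simp_all

theorem ZASM_eq_triangleSum {R : Type*} [CommRing R] (n : ℕ) (x y : R) :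
    ZASM n x y 1 = triangleSum x y n (Finset.univ : Finset (Fin n)) := by
  classical
  -- This test function imposes that all column sums are `1`.
  have h := sum_prod_rowWeight x y n fun S : Finset (Fin n) => if S = Finset.univ then 1 else 0
  simp only [mul_ite, mul_one, mul_zero, Finset.sum_ite_eq', Finset.mem_univ, if_true,
    ← ite_and] at h
  rw [← h, ← Finset.sum_filter, ZASM]
  refine Finset.sum_nbij' chainOfMatrix matrixOfChain ?_ ?_ ?_ ?_ ?_
  · intro A hA
    obtain ⟨h1, h2⟩ := (isASM_iff_isSignRow A).1 (mem_ASM.1 hA)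
    refine Finset.mem_filter.2 ⟨Finset.mem_univ _, ⟨?_, fun k => ?_⟩, ?_⟩
    · simp [chainOfMatrix, prefixSum_zero]
    · change IsSignRow (matrixOfChain (chainOfMatrix A) k)
      rw [matrixOfChain_chainOfMatrix h2]
      exact h1 k
    · ext j
      simp [chainOfMatrix, prefixSum_of_le, (h2 j).sum_eq]
  · intro s hs
    obtain ⟨-, ⟨h1, h2⟩, h3⟩ := Finset.mem_filter.1 hs
    exact mem_ASM.2 (isASM_matrixOfChain h1 h3 h2)
  · intro A hA
    exact matrixOfChain_chainOfMatrix ((isASM_iff_isSignRow A).1 (mem_ASM.1 hA)).2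
  · intro s hs
    obtain ⟨-, ⟨h1, -⟩, -⟩ := Finset.mem_filter.1 hs
    ext k j
    simp [chainOfMatrix, prefixSum_matrixOfChain h1]
  · intro A hA
    obtain ⟨h1, h2⟩ := (isASM_iff_isSignRow A).1 (mem_ASM.1 hA)
    have e := matrixOfChain_chainOfMatrix h2
    have h0 : chainOfMatrix A 0 = ∅ := by simp [chainOfMatrix, prefixSum_zero]
    have e1 := asmNu_matrixOfChain h0 (by rw [e]; exact h1)
    have e2 := asmMu_matrixOfChain (chainOfMatrix A)
    rw [e] at e1 e2
    rw [e1, e2, one_pow, mul_one, ← Finset.prod_pow_eq_pow_sum, ← Finset.prod_pow_eq_pow_sum,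
      ← Finset.prod_mul_distrib]
    rfl

theorem mainTheorem5 {R : Type*} [CommRing R] (n : ℕ) (u : R) :
    ZASM n (u - 1) u 1 = u ^ (n * (n - 1) / 2) := by
  rw [ZASM_eq_triangleSum]
  simpa using triangleSum_univ (u - 1) n
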